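/- A matching on $[2n]=\{1,2,\ldots,2n\}$ is a partition of $[2n]$ into blocks of exactly two elements (edges); the smaller element of an edge is its initial point. Its canonical sequential form is the sequence of length $2n$ obtained by labelling the edges $1,2,\ldots,n$ in increasing order of their initial points and writing at each node the label of its edge. A matching contains a pattern $\tau=\tau_1\cdots\tau_k$ if its canonical sequential form has a (not necessarily consecutive) subsequence $\pi_1\cdots\pi_k$ such that, for all $1\le i,j\le k$, $\pi_i<\pi_j$ if and only if $\tau_i<\tau_j$; otherwise it avoids $\tau$. Let $\mathcal M_n(\tau)$ be the set of matchings on $[2n]$ that avoid $\tau$, and let $$C_{n,3}=\frac{1}{2n+1}\binom{3n}{n}$$ be the $3$-Catalan number. **Theorem.** For every $\tau\in\{12312,\,12132,\,12123,\,12321,\,12231,\,12213\}$ and every integer $n\ge 0$, $$|\mathcal M_n(\tau)|=C_{n,3}.$$ In particular these six patterns are pairwise Wilf-equivalent: any two of them are avoided by the same number of matchings on $[2n]$, for every $n$. -/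

import Mathlib

/-- A matching on `[2n]`: a partition of the `2n` linearly ordered nodes (here `Fin (2 * n)`)
in which every block contains exactly two elements. -/
def Matching (n : ℕ) : Type :=
  {P : Finpartition (Finset.univ : Finset (Fin (2 * n))) // ∀ B ∈ P.parts, B.card = 2}

/-- The canonical sequential form of a matching: the edges are labelled `1, 2, …, n` in the order
of appearance of their initial points (their smaller nodes), and each node carries the label of
its edge. So the label of the node `v` is the number of edges whose initial point is not to the
right of the initial point of the edge at `v`. -/
def Matching.canonicalForm {n : ℕ} (M : Matching n) (v : Fin (2 * n)) : ℕ :=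
  (M.1.parts.filter fun B => B.min ≤ (M.1.part v).min).card

/-- Two sequences of length `k` are order-isomorphic. -/
def OrderIsomorphic {k : ℕ} (s t : Fin k → ℕ) : Prop :=
  ∀ i j : Fin k, s i < s j ↔ t i < t j

/-- `M` contains an occurrence of the pattern `τ`: some (not necessarily consecutive) subsequence
of the canonical sequential form of `M` is order-isomorphic to `τ`. -/
def Matching.Contains {n k : ℕ} (M : Matching n) (τ : Fin k → ℕ) : Prop :=
  ∃ f : Fin k → Fin (2 * n), StrictMono f ∧ OrderIsomorphic (fun i => M.canonicalForm (f i)) τ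

/-- The set of all `τ`-avoiding matchings on `[2n]`. -/
def avoidingMatchings (n : ℕ) {k : ℕ} (τ : Fin k → ℕ) : Set (Matching n) :=
  {M | ¬ M.Contains τ}

/-- Two patterns are Wilf-equivalent (for matchings) if, for every `n`, they are avoided by equally
many matchings on `[2n]`. -/
def WilfEquivalent {k l : ℕ} (σ : Fin k → ℕ) (τ : Fin l → ℕ) : Prop :=
  ∀ n : ℕ, (avoidingMatchings n σ).ncard = (avoidingMatchings n τ).ncard

/-- The `k`-Catalan number `C_{n,k} = (1 / ((k - 1) n + 1)) * binom(k n, n)`. -/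
def kCatalan (n k : ℕ) : ℚ :=
  1 / (((k : ℚ) - 1) * n + 1) * ((k * n).choose n : ℚ)

/-- The six partial patterns 12312, 12132, 12123, 12321, 12231, 12213. -/
def sixPatterns : Set (Fin 5 → ℕ) :=
  {![1, 2, 3, 1, 2], ![1, 2, 1, 3, 2], ![1, 2, 1, 2, 3],
    ![1, 2, 3, 2, 1], ![1, 2, 2, 3, 1], ![1, 2, 2, 1, 3]}

/-!
Each of the six patterns has the form `1 s 1 t`, where `s` and `t` are words in the letters `2` and
`3`. A matching with `n + 1` edges is obtained from one with `n` edges by adding a new first edge,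
and the position of its end is arbitrary. As the new edge has the smallest label, it can only play
the role of the letter `1` in an occurrence of the pattern. Hence the matching remains avoiding
exactly if the new edge ends in an *active* gap: one that does not have an occurrence of `s` on its
left and of `t` on its right, in two common letters (`hasPattern_insertEdge`).

The avoiding matchings are therefore the nodes of a generating tree, and the number of children
of a node is its number of active gaps. A gap that is active before an edge is added can only
be blocked afterwards by that edge itself, in the role of the letter `2`
(`card_activeGaps_insertEdge`). This allows one to check, for each of the six patterns, that the
children of a node with `h` active gaps have `3, 4, …, h + 2` active gaps in some order
(`TernaryRule`). So all six trees are the same, and the number of nodes at depth `n` is determined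
by a recursion whose solution is a ballot number (`ternaryCount_mul_factorial`), which specializes
to the `3`-Catalan number at the root.

The tree is built on words instead of matchings: the canonical sequential forms, with labels
shifted so that adding a first edge does not relabel the other edges. They are characterized by
`IsCanonicalWord`, and `Matching.isCanonicalWord_word`, `Matching.word_injective` and
`IsCanonicalWord.exists_matching` show that they correspond bijectively to matchings.
-/

/-! ### Ternary succession rule -/

/-- The number of nodes at depth `n` below a node with `h` children in the generating tree in which
a node with `h` children has children with `3, 4, …, h + 2` children. -/
def ternaryCount : ℕ → ℕ → ℕ
  | 0, _ => 1
  | n + 1, h => ∑ i ∈ Finset.range h, ternaryCount n (i + 3)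

/-- The closed form `(h + 1) (3n + h)! / (n! (2n + h + 1)!)`, a ballot number. It follows from
`ternaryCount (n + 1) (h + 1) = ternaryCount (n + 1) h + ternaryCount n (h + 3)`. -/
theorem ternaryCount_mul_factorial (n h : ℕ) :
    ternaryCount n (h + 1) * (n.factorial * (2 * n + h + 1).factorial) =
      (h + 1) * (3 * n + h).factorial := by
  induction n generalizing h with
  | zero => simp [ternaryCount, Nat.factorial_succ]
  | succ n ih =>
    have step (h : ℕ) : ternaryCount (n + 1) (h + 1) =
        ternaryCount (n + 1) h + ternaryCount n (h + 3) := by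
      simp [ternaryCount, Finset.sum_range_succ]
    induction h with
    | zero =>
      have h0 : ternaryCount (n + 1) 0 = 0 := by simp [ternaryCount]
      have h2 := ih 2
      rw [step 0, h0, show 2 * (n + 1) + 0 + 1 = 2 * n + 2 + 1 by ring,
        show 3 * (n + 1) + 0 = (3 * n + 2) + 1 by ring, Nat.factorial_succ n,
        Nat.factorial_succ (3 * n + 2)]
      simp only [zero_add]
      linear_combination (n + 1) * h2
    | succ h ihh =>
      have h2 := ih (h + 3)
      rw [step (h + 1), show 2 * (n + 1) + (h + 1) + 1 = (2 * n + h + 3) + 1 by ring,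
        show 3 * (n + 1) + (h + 1) = (3 * n + h + 3) + 1 by ring,
        Nat.factorial_succ (3 * n + h + 3), Nat.factorial_succ n]
      rw [show 2 * n + (h + 3) + 1 = (2 * n + h + 3) + 1 by ring,
        show 3 * n + (h + 3) = 3 * n + h + 3 by ring] at h2
      rw [show 2 * (n + 1) + h + 1 = 2 * n + h + 3 by ring,
        show 3 * (n + 1) + h = 3 * n + h + 3 by ring, Nat.factorial_succ n] at ihh
      rw [Nat.factorial_succ (2 * n + h + 3)] at h2 ⊢
      linear_combination (2 * n + h + 4) * ihh + (n + 1) * h2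

theorem ternaryCount_one (n : ℕ) : (ternaryCount n 1 : ℚ) = kCatalan n 3 := by
  have h1 : ternaryCount n 1 * (n.factorial * (2 * n + 1).factorial) = (3 * n).factorial := by
    simpa using ternaryCount_mul_factorial n 0
  have h2 : (3 * n).choose n * n.factorial * (2 * n).factorial = (3 * n).factorial := by
    have := Nat.choose_mul_factorial_mul_factorial (show n ≤ 3 * n by lia)
    rwa [show 3 * n - n = 2 * n by lia] at this
  have h3 : ternaryCount n 1 * (2 * n + 1) = (3 * n).choose n := by
    have hpos : 0 < n.factorial * (2 * n).factorial := by positivity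
    refine Nat.eq_of_mul_eq_mul_right hpos ?_
    rw [Nat.factorial_succ] at h1
    linear_combination h1 - h2
  have h4 : (ternaryCount n 1 : ℚ) * (2 * n + 1) = (3 * n).choose n := by exact_mod_cast h3
  have h5 : (2 * n + 1 : ℚ) ≠ 0 := by positivity
  rw [kCatalan, ← h4]
  push_cast
  rw [show ((3 : ℚ) - 1) * n + 1 = 2 * n + 1 by ring]
  field_simp

/-- Summing a function of the rank over a finite set of natural numbers, counted from below. -/
theorem Finset.sum_card_filter_le (G : Finset ℕ) (f : ℕ → ℕ) :
    ∑ p ∈ G, f (G.filter (· ≤ p)).card = ∑ i ∈ Finset.range G.card, f (i + 1) := by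
  induction G using Finset.induction_on_max with
  | empty => simp
  | insert a G ha ih =>
    have hn : a ∉ G := fun h => lt_irrefl _ (ha a h)
    rw [Finset.sum_insert hn, Finset.card_insert_of_notMem hn, Finset.sum_range_succ, add_comm,
      ← ih]
    congr 1
    · refine Finset.sum_congr rfl fun p hp => ?_
      rw [Finset.filter_insert, if_neg (not_le.2 (ha p hp))]
    · rw [Finset.filter_true_of_mem, Finset.card_insert_of_notMem hn]
      intro x hx
      rcases Finset.mem_insert.1 hx with rfl | hx
      · exact le_rfl
      · exact (ha x hx).le

/-- Summing a function of the rank over a finite set of natural numbers, counted from above. -/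
theorem Finset.sum_card_filter_ge (G : Finset ℕ) (f : ℕ → ℕ) :
    ∑ p ∈ G, f (G.filter (p ≤ ·)).card = ∑ i ∈ Finset.range G.card, f (i + 1) := by
  induction G using Finset.induction_on_min with
  | empty => simp
  | insert a G ha ih =>
    have hn : a ∉ G := fun h => lt_irrefl _ (ha a h)
    rw [Finset.sum_insert hn, Finset.card_insert_of_notMem hn, Finset.sum_range_succ, add_comm,
      ← ih]
    congr 1
    · refine Finset.sum_congr rfl fun p hp => ?_
      rw [Finset.filter_insert, if_neg (not_le.2 (ha p hp))]
    · rw [Finset.filter_true_of_mem, Finset.card_insert_of_notMem hn]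
      intro x hx
      rcases Finset.mem_insert.1 hx with rfl | hx
      · exact le_rfl
      · exact (ha x hx).le

/-! ### Words and active gaps -/

/-- The word obtained from a word `s` on two letters by writing `b` for `false` and `c` for
`true`. -/
def spell (b c : ℤ) (s : List Bool) : List ℤ := s.map fun e => cond e c b

/-- `w` contains the pattern `1 s 1 t`, where `s` and `t` are words in the two larger letters of
the pattern. -/
def HasPattern (s t : List Bool) (w : List ℤ) : Prop :=
  ∃ a b c, a < b ∧ b < c ∧ List.Sublist (a :: (spell b c s ++ a :: spell b c t)) w

/-- The gap between `x` and `y` in the word `x ++ y` is blocked if an edge with a new smallest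
label that starts at the front and ends in this gap creates the pattern `1 s 1 t`. -/
def Blocked (s t : List Bool) (x y : List ℤ) : Prop :=
  ∃ b c, b < c ∧ List.Sublist (spell b c s) x ∧ List.Sublist (spell b c t) y

/-- The blocking of a gap by an occurrence whose smaller letter is the given letter `m`. -/
def BlockedBy (s t : List Bool) (m : ℤ) (x y : List ℤ) : Prop :=
  ∃ c, m < c ∧ List.Sublist (spell m c s) x ∧ List.Sublist (spell m c t) y

/-- The word obtained by adding an edge labelled `m` that starts at the front of `w` and ends in
gap `p`, the gap after the first `p` letters. -/
def insertEdge (m : ℤ) (w : List ℤ) (p : ℕ) : List ℤ := m :: (w.take p ++ m :: w.drop p)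

open Classical in
/-- The gaps of `w` that are not blocked. -/
noncomputable def activeGaps (s t : List Bool) (w : List ℤ) : Finset ℕ :=
  (Finset.range (w.length + 1)).filter fun p => ¬ Blocked s t (w.take p) (w.drop p)

theorem mem_activeGaps {s t : List Bool} {w : List ℤ} {p : ℕ} :
    p ∈ activeGaps s t w ↔ p ≤ w.length ∧ ¬ Blocked s t (w.take p) (w.drop p) := by
  simp [activeGaps]

theorem mem_spell {b c x : ℤ} {s : List Bool} (h : x ∈ spell b c s) : x = b ∨ x = c := by
  obtain ⟨e, -, rfl⟩ := List.mem_map.1 h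
  cases e <;> simp

theorem mem_spell_of_false_mem {b c : ℤ} {s : List Bool} (h : false ∈ s) : b ∈ spell b c s :=
  List.mem_map.2 ⟨false, h, rfl⟩

/-- A list without the letter `m` embeds in a list iff it embeds after deleting `m`. -/
theorem sublist_filter_ne_iff {l w : List ℤ} {m : ℤ} (hl : m ∉ l) :
    List.Sublist l (w.filter (· ≠ m)) ↔ List.Sublist l w := by
  refine ⟨fun h => h.trans List.filter_sublist, fun h => ?_⟩
  have := h.filter (· ≠ m)
  rwa [List.filter_eq_self.2 fun x hx => by
    simpa using fun e : x = m => hl (e ▸ hx)] at this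

theorem filter_ne_eq_self {l : List ℤ} {m : ℤ} (hl : ∀ x ∈ l, m < x) :
    l.filter (· ≠ m) = l :=
  List.filter_eq_self.2 fun x hx => by simpa using (hl x hx).ne'

theorem blocked_iff {s t : List Bool} (hs : false ∈ s) {m : ℤ} {u v : List ℤ}
    (hu : ∀ x ∈ u, m ≤ x) :
    Blocked s t u v ↔
      BlockedBy s t m u v ∨ Blocked s t (u.filter (· ≠ m)) (v.filter (· ≠ m)) := by
  constructor
  · rintro ⟨b, c, hbc, h1, h2⟩
    rcases eq_or_ne b m with rfl | hb
    · exact Or.inl ⟨c, hbc, h1, h2⟩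
    · have hmb : m ≤ b := hu b (h1.subset (mem_spell_of_false_mem hs))
      have hne (r : List Bool) : m ∉ spell b c r := fun h => by
        rcases mem_spell h with h | h <;> lia
      exact Or.inr ⟨b, c, hbc, (sublist_filter_ne_iff (hne s)).2 h1,
        (sublist_filter_ne_iff (hne t)).2 h2⟩
  · rintro (⟨c, hc, h1, h2⟩ | ⟨b, c, hbc, h1, h2⟩)
    · exact ⟨m, c, hc, h1, h2⟩
    · exact ⟨b, c, hbc, h1.trans List.filter_sublist, h2.trans List.filter_sublist⟩

theorem filter_ne_cons_append_cons {m : ℤ} {x y : List ℤ} (hx : ∀ z ∈ x, m < z)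
    (hy : ∀ z ∈ y, m < z) : (m :: (x ++ m :: y)).filter (· ≠ m) = x ++ y := by
  rw [List.filter_cons_of_neg (by simp), List.filter_append, List.filter_cons_of_neg (by simp),
    filter_ne_eq_self hx, filter_ne_eq_self hy]

theorem mem_insertEdge {m : ℤ} {w : List ℤ} {p : ℕ} {x : ℤ} :
    x ∈ insertEdge m w p ↔ x = m ∨ x ∈ w := by
  have : x ∈ w ↔ x ∈ w.take p ∨ x ∈ w.drop p := by
    rw [← List.mem_append, List.take_append_drop]
  rw [this]
  simp [insertEdge]
  tauto

theorem append_cons_sublist_iff {m : ℤ} {x y l r : List ℤ} (hx : m ∉ x) (hy : m ∉ y)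
    (hl : m ∉ l) :
    List.Sublist (l ++ m :: r) (x ++ m :: y) ↔ List.Sublist l x ∧ List.Sublist r y := by
  refine ⟨fun h => ?_, fun ⟨h1, h2⟩ => h1.append (h2.cons_cons m)⟩
  obtain ⟨l₁, l₂, he, h1, h2⟩ := List.sublist_append_iff.1 h
  rcases List.append_eq_append_iff.1 he with ⟨a, rfl, ha⟩ | ⟨a, rfl, ha⟩
  · cases a with
    | nil =>
      simp only [List.nil_append] at ha
      subst ha
      simp only [List.append_nil] at h1
      exact ⟨h1, List.cons_sublist_cons.1 h2⟩
    | cons z a =>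
      simp only [List.cons_append, List.cons.injEq] at ha
      obtain ⟨rfl, -⟩ := ha
      exact absurd (h1.subset (by simp)) hx
  · cases a with
    | nil =>
      simp only [List.nil_append] at ha
      subst ha
      simp only [List.append_nil]
      exact ⟨h1, List.cons_sublist_cons.1 h2⟩
    | cons z a =>
      subst ha
      rcases List.sublist_cons_iff.1 h2 with h2 | ⟨r', hr, h2⟩
      · exact absurd (h2.subset (by simp)) hy
      · simp only [List.cons_append, List.cons.injEq] at hr
        exact absurd hr.1 (fun e => hl (by simp [e]))

/-- Adding a first edge creates a pattern exactly if its end lies in a blocked gap. -/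
theorem hasPattern_insertEdge {s t : List Bool} (hs : false ∈ s) {m : ℤ} {w : List ℤ}
    (hw : ∀ x ∈ w, m < x) (p : ℕ) :
    HasPattern s t (insertEdge m w p) ↔
      HasPattern s t w ∨ Blocked s t (w.take p) (w.drop p) := by
  have hx : ∀ z ∈ w.take p, m < z := fun z hz => hw z (List.mem_of_mem_take hz)
  have hy : ∀ z ∈ w.drop p, m < z := fun z hz => hw z (List.mem_of_mem_drop hz)
  have hf : (insertEdge m w p).filter (· ≠ m) = w := by
    rw [insertEdge, filter_ne_cons_append_cons hx hy, List.take_append_drop]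
  constructor
  · rintro ⟨a, b, c, hab, hbc, h⟩
    have hma : m ≤ a := by
      rcases mem_insertEdge.1 (h.subset List.mem_cons_self) with h | h
      · exact h.ge
      · exact (hw a h).le
    have hne (r : List Bool) : m ∉ spell b c r := fun h => by
      rcases mem_spell h with h | h <;> lia
    rcases hma.eq_or_lt with rfl | hma
    · rw [insertEdge, List.cons_sublist_cons, append_cons_sublist_iff
        (fun h => lt_irrefl _ (hx _ h)) (fun h => lt_irrefl _ (hy _ h)) (hne s)] at h
      exact Or.inr ⟨b, c, hbc, h⟩
    · refine Or.inl ⟨a, b, c, hab, hbc, ?_⟩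
      rwa [← hf, sublist_filter_ne_iff]
      simp [hne, hma.ne]
  · rintro (⟨a, b, c, hab, hbc, h⟩ | ⟨b, c, hbc, h1, h2⟩)
    · refine ⟨a, b, c, hab, hbc, ?_⟩
      rw [← hf] at h
      exact h.trans List.filter_sublist
    · exact ⟨m, b, c, hw b (List.mem_of_mem_take (h1.subset (mem_spell_of_false_mem hs))), hbc,
        (h1.append (h2.cons_cons m)).cons_cons m⟩

open Classical in
/-- The active gaps after adding a first edge: the new front gap, and the old active gaps inside
and after the new edge (gap `p` is split into two), except those which are now blocked by the new
edge itself. -/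
theorem card_activeGaps_insertEdge {s t : List Bool} (hs : false ∈ s) {m : ℤ} {w : List ℤ}
    (hw : ∀ x ∈ w, m < x) {p : ℕ} (hp : p ≤ w.length) :
    (activeGaps s t (insertEdge m w p)).card =
      1 + ((activeGaps s t w).filter fun i => i ≤ p ∧
        ¬ BlockedBy s t m (m :: w.take i) ((w.take p).drop i ++ m :: w.drop p)).card +
      ((activeGaps s t w).filter fun i => p ≤ i ∧
        ¬ BlockedBy s t m (m :: (w.take p ++ m :: (w.drop p).take (i - p))) (w.drop i)).card := by
  have hx : ∀ k, ∀ z ∈ w.take k, m < z := fun k z hz => hw z (List.mem_of_mem_take hz)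
  have hy : ∀ k, ∀ z ∈ w.drop k, m < z := fun k z hz => hw z (List.mem_of_mem_drop hz)
  have hlen : (insertEdge m w p).length = w.length + 2 := by
    simp [insertEdge]; lia
  have hzero : 0 ∈ activeGaps s t (insertEdge m w p) := by
    refine mem_activeGaps.2 ⟨Nat.zero_le _, ?_⟩
    rintro ⟨b, c, -, h, -⟩
    have := h.subset (mem_spell_of_false_mem hs)
    simp at this
  have hin (i : ℕ) (hi : i ≤ p) : i + 1 ∈ activeGaps s t (insertEdge m w p) ↔
      i ∈ activeGaps s t w ∧
        ¬ BlockedBy s t m (m :: w.take i) ((w.take p).drop i ++ m :: w.drop p) := by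
    have e1 : (insertEdge m w p).take (i + 1) = m :: w.take i := by
      rw [insertEdge, List.take_succ_cons, List.take_append_of_le_length (by simp; lia),
        List.take_take, min_eq_left hi]
    have e2 : (insertEdge m w p).drop (i + 1) = (w.take p).drop i ++ m :: w.drop p := by
      rw [insertEdge, List.drop_succ_cons, List.drop_append_of_le_length (by simp; lia)]
    have e3 : (w.take p).drop i ++ w.drop p = w.drop i := by
      conv_rhs => rw [← List.take_append_drop p w]
      rw [List.drop_append_of_le_length (by simp; lia)]
    have e4 : ∀ z ∈ (w.take p).drop i, m < z := fun z hz => hx p z (List.mem_of_mem_drop hz)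
    rw [mem_activeGaps, mem_activeGaps, hlen, e1, e2, blocked_iff hs (m := m)]
    · rw [List.filter_cons_of_neg (by simp), List.filter_append, List.filter_cons_of_neg (by simp),
        filter_ne_eq_self (hx i), filter_ne_eq_self (hy p), filter_ne_eq_self e4, e3]
      have : i + 1 ≤ w.length + 2 ↔ i ≤ w.length := by lia
      rw [this]
      tauto
    · intro z hz
      rcases List.mem_cons.1 hz with rfl | hz
      · exact le_rfl
      · exact (hx i z hz).le
  have hout (i : ℕ) (hi : p ≤ i) : i + 2 ∈ activeGaps s t (insertEdge m w p) ↔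
      i ∈ activeGaps s t w ∧
        ¬ BlockedBy s t m (m :: (w.take p ++ m :: (w.drop p).take (i - p))) (w.drop i) := by
    have hlp : (w.take p).length = p := by simp [hp]
    have e1 : (insertEdge m w p).take (i + 2) =
        m :: (w.take p ++ m :: (w.drop p).take (i - p)) := by
      rw [insertEdge, List.take_succ_cons, List.take_append, hlp,
        List.take_of_length_le (l := w.take p) (by lia), show i + 1 - p = (i - p) + 1 by lia,
        List.take_succ_cons]
    have e2 : (insertEdge m w p).drop (i + 2) = w.drop i := by
      rw [insertEdge, List.drop_succ_cons, List.drop_append, hlp,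
        List.drop_of_length_le (l := w.take p) (by lia), show i + 1 - p = (i - p) + 1 by lia,
        List.drop_succ_cons, List.drop_drop, List.nil_append, show p + (i - p) = i by lia]
    have e3 : w.take p ++ (w.drop p).take (i - p) = w.take i := by
      rw [show i = p + (i - p) by lia, List.take_add, show p + (i - p) - p = i - p by lia]
    have e4 : ∀ z ∈ (w.drop p).take (i - p), m < z :=
      fun z hz => hy p z (List.mem_of_mem_take hz)
    rw [mem_activeGaps, mem_activeGaps, hlen, e1, e2, blocked_iff hs (m := m)]
    · rw [filter_ne_cons_append_cons (hx p) e4, filter_ne_eq_self (hy i), e3]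
      have : i + 2 ≤ w.length + 2 ↔ i ≤ w.length := by lia
      rw [this]
      tauto
    · intro z hz
      simp only [List.mem_cons, List.mem_append] at hz
      rcases hz with rfl | hz | rfl | hz
      · exact le_rfl
      · exact (hx p z hz).le
      · exact le_rfl
      · exact (e4 z hz).le
  set A := (activeGaps s t w).filter fun i => i ≤ p ∧
        ¬ BlockedBy s t m (m :: w.take i) ((w.take p).drop i ++ m :: w.drop p) with hA
  set B := (activeGaps s t w).filter fun i => p ≤ i ∧
        ¬ BlockedBy s t m (m :: (w.take p ++ m :: (w.drop p).take (i - p))) (w.drop i) with hB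
  have hunion : activeGaps s t (insertEdge m w p) =
      insert 0 (A.image (· + 1) ∪ B.image (· + 2)) := by
    ext q
    simp only [Finset.mem_insert, Finset.mem_union, Finset.mem_image, hA, hB, Finset.mem_filter]
    constructor
    · intro hq
      rcases q with _ | q
      · exact Or.inl rfl
      · refine Or.inr ?_
        rcases le_or_gt q p with h | h
        · exact Or.inl ⟨q, ⟨((hin q h).1 hq).1, h, ((hin q h).1 hq).2⟩, rfl⟩
        · obtain ⟨i, rfl⟩ : ∃ i, q = i + 1 := ⟨q - 1, by lia⟩
          have h' : p ≤ i := by lia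
          exact Or.inr ⟨i, ⟨((hout i h').1 hq).1, h', ((hout i h').1 hq).2⟩, rfl⟩
    · rintro (rfl | ⟨i, ⟨h1, h2, h3⟩, rfl⟩ | ⟨i, ⟨h1, h2, h3⟩, rfl⟩)
      · exact hzero
      · exact (hin i h2).2 ⟨h1, h3⟩
      · exact (hout i h2).2 ⟨h1, h3⟩
  rw [hunion, Finset.card_insert_of_notMem (by simp), Finset.card_union_of_disjoint,
    Finset.card_image_of_injective _ (add_left_injective 1),
    Finset.card_image_of_injective _ (add_left_injective 2)]
  · lia
  · rw [Finset.disjoint_left]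
    intro q h1 h2
    simp only [Finset.mem_image, hA, hB, Finset.mem_filter] at h1 h2
    obtain ⟨i, ⟨-, hi, -⟩, rfl⟩ := h1
    obtain ⟨j, ⟨-, hj, -⟩, hij⟩ := h2
    lia

/-! ### The six patterns obey the ternary succession rule -/

/-- The pattern `1 s 1 t` obeys the ternary succession rule: adding a first edge in all possible
ways to a word with `h` active gaps gives words with `3, 4, …, h + 2` active gaps. The multiset
of these numbers is tested against an arbitrary function. -/
def TernaryRule (s t : List Bool) : Prop :=
  ∀ (m : ℤ) (w : List ℤ), (∀ x ∈ w, m < x) → ∀ f : ℕ → ℕ,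
    ∑ p ∈ activeGaps s t w, f (activeGaps s t (insertEdge m w p)).card =
      ∑ i ∈ Finset.range (activeGaps s t w).card, f (i + 3)

theorem zero_mem_activeGaps {s t : List Bool} (hs : false ∈ s) (w : List ℤ) :
    0 ∈ activeGaps s t w := by
  refine mem_activeGaps.2 ⟨Nat.zero_le _, ?_⟩
  rintro ⟨b, c, -, h, -⟩
  simpa using h.subset (mem_spell_of_false_mem hs)

theorem length_mem_activeGaps {s t : List Bool} (ht : t ≠ []) (w : List ℤ) :
    w.length ∈ activeGaps s t w := by
  refine mem_activeGaps.2 ⟨le_rfl, ?_⟩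
  rintro ⟨b, c, -, -, h⟩
  rw [List.drop_length, List.sublist_nil, spell, List.map_eq_nil_iff] at h
  exact ht h

theorem exists_singleton_sublist_iff {m : ℤ} {x : List ℤ} (hx : ∀ z ∈ x, m < z) :
    (∃ c, m < c ∧ List.Sublist [c] x) ↔ x ≠ [] := by
  simp only [List.singleton_sublist]
  constructor
  · rintro ⟨c, -, hc⟩ rfl
    simp at hc
  · intro h
    obtain ⟨c, hc⟩ := List.exists_mem_of_ne_nil x h
    exact ⟨c, hx c hc, hc⟩

theorem singleton_filter_card {G : Finset ℕ} {P : ℕ → Prop} [DecidablePred P] {a : ℕ}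
    (ha : a ∈ G) (hP : ∀ i ∈ G, P i ↔ i = a) : (G.filter P).card = 1 := by
  rw [Finset.card_eq_one]
  refine ⟨a, ?_⟩
  ext i
  simp only [Finset.mem_filter, Finset.mem_singleton]
  exact ⟨fun h => (hP i h.1).1 h.2, fun h => ⟨h ▸ ha, (hP i (h ▸ ha)).2 h⟩⟩

theorem TernaryRule.of_card_le {s t : List Bool}
    (h : ∀ (m : ℤ) (w : List ℤ), (∀ x ∈ w, m < x) → ∀ p ∈ activeGaps s t w,
      (activeGaps s t (insertEdge m w p)).card =
        ((activeGaps s t w).filter (· ≤ p)).card + 2) : TernaryRule s t := by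
  intro m w hw f
  rw [Finset.sum_congr rfl fun p hp => by rw [h m w hw p hp]]
  exact Finset.sum_card_filter_le _ fun k => f (k + 2)

theorem TernaryRule.of_card_ge {s t : List Bool}
    (h : ∀ (m : ℤ) (w : List ℤ), (∀ x ∈ w, m < x) → ∀ p ∈ activeGaps s t w,
      (activeGaps s t (insertEdge m w p)).card =
        ((activeGaps s t w).filter (p ≤ ·)).card + 2) : TernaryRule s t := by
  intro m w hw f
  rw [Finset.sum_congr rfl fun p hp => by rw [h m w hw p hp]]
  exact Finset.sum_card_filter_ge _ fun k => f (k + 2)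

/-- The pattern 12312. The new edge blocks all gaps between its ends except the first one. -/
theorem ternaryRule_12312 : TernaryRule [false, true] [false] := by
  classical
  refine .of_card_ge fun m w hw p hp => ?_
  have hpl := (mem_activeGaps.1 hp).1
  rw [card_activeGaps_insertEdge (by simp) hw hpl,
    singleton_filter_card (zero_mem_activeGaps (by simp) w), Finset.filter_congr
      (q := (p ≤ ·))]
  · lia
  · intro i _
    have : m ∉ w.drop i := fun h => lt_irrefl _ (hw _ (List.mem_of_mem_drop h))
    simp [BlockedBy, spell, this]
  · intro i hi
    have hil := (mem_activeGaps.1 hi).1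
    have hx : ∀ z ∈ w.take i, m < z := fun z hz => hw z (List.mem_of_mem_take hz)
    have key : BlockedBy [false, true] [false] m (m :: w.take i)
        ((w.take p).drop i ++ m :: w.drop p) ↔ w.take i ≠ [] := by
      rw [← exists_singleton_sublist_iff hx]
      simp [BlockedBy, spell]
    rw [key, not_not, List.take_eq_nil_iff]
    constructor
    · rintro ⟨-, h | rfl⟩
      · exact h
      · simpa using hil
    · rintro rfl
      simp

/-- The pattern 12132. The new edge blocks all gaps between its ends except the last one. -/
theorem ternaryRule_12132 : TernaryRule [false] [true, false] := by
  classical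
  refine .of_card_ge fun m w hw p hp => ?_
  have hpl := (mem_activeGaps.1 hp).1
  rw [card_activeGaps_insertEdge (by simp) hw hpl, singleton_filter_card hp, Finset.filter_congr
      (q := (p ≤ ·))]
  · lia
  · intro i _
    have h1 : m ∉ w.drop i := fun h => lt_irrefl _ (hw _ (List.mem_of_mem_drop h))
    have h2 (c : ℤ) : ¬ List.Sublist [c, m] (w.drop i) := fun h => h1 (h.subset (by simp))
    simp [BlockedBy, spell, h2]
  · intro i hi
    have hy : ∀ z ∈ w.drop p, m < z := fun z hz => hw z (List.mem_of_mem_drop hz)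
    have hx : ∀ z ∈ (w.take p).drop i, m < z :=
      fun z hz => hw z (List.mem_of_mem_take (List.mem_of_mem_drop hz))
    have key : BlockedBy [false] [true, false] m (m :: w.take i)
        ((w.take p).drop i ++ m :: w.drop p) ↔ (w.take p).drop i ≠ [] := by
      rw [← exists_singleton_sublist_iff hx]
      refine exists_congr fun c => and_congr_right fun hc => ?_
      have := append_cons_sublist_iff (l := [c]) (r := []) (fun h => lt_irrefl _ (hx _ h))
        (fun h => lt_irrefl _ (hy _ h)) (by simpa using hc.ne)
      simpa [spell] using this
    rw [key, not_not, List.drop_eq_nil_iff, List.length_take, min_eq_left hpl]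
    lia

/-- The pattern 12231. The new edge blocks all gaps behind it except the one right after its end. -/
theorem ternaryRule_12231 : TernaryRule [false, false, true] [] := by
  classical
  refine .of_card_le fun m w hw p hp => ?_
  have hpl := (mem_activeGaps.1 hp).1
  have hone : ∀ i ∈ activeGaps [false, false, true] [] w,
      (p ≤ i ∧ ¬ BlockedBy [false, false, true] [] m
        (m :: (w.take p ++ m :: (w.drop p).take (i - p))) (w.drop i)) ↔ i = p := by
    intro i hi
    have hil := (mem_activeGaps.1 hi).1
    have hx : ∀ z ∈ w.take p, m < z := fun z hz => hw z (List.mem_of_mem_take hz)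
    have hy : ∀ z ∈ (w.drop p).take (i - p), m < z :=
      fun z hz => hw z (List.mem_of_mem_drop (List.mem_of_mem_take hz))
    have key : BlockedBy [false, false, true] [] m
        (m :: (w.take p ++ m :: (w.drop p).take (i - p))) (w.drop i) ↔
        (w.drop p).take (i - p) ≠ [] := by
      rw [← exists_singleton_sublist_iff hy]
      refine exists_congr fun c => and_congr_right fun hc => ?_
      have := append_cons_sublist_iff (l := []) (r := [c]) (fun h => lt_irrefl _ (hx _ h))
        (fun h => lt_irrefl _ (hy _ h)) (by simp)
      simpa [spell] using this
    rw [key, not_not, List.take_eq_nil_iff, List.drop_eq_nil_iff]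
    lia
  rw [card_activeGaps_insertEdge (by simp) hw hpl, Finset.filter_congr (q := (· ≤ p)),
    singleton_filter_card hp hone]
  · lia
  · intro i _
    have h1 : m ∉ w.take i := fun h => lt_irrefl _ (hw _ (List.mem_of_mem_take h))
    have h2 (c : ℤ) : ¬ List.Sublist [m, c] (w.take i) := fun h => h1 (h.subset (by simp))
    simp [BlockedBy, spell, h2]

/-- The pattern 12213. The new edge blocks all gaps behind it except the last gap of the word. -/
theorem ternaryRule_12213 : TernaryRule [false, false] [true] := by
  classical
  refine .of_card_le fun m w hw p hp => ?_
  have hpl := (mem_activeGaps.1 hp).1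
  have hone : ∀ i ∈ activeGaps [false, false] [true] w,
      (p ≤ i ∧ ¬ BlockedBy [false, false] [true] m
        (m :: (w.take p ++ m :: (w.drop p).take (i - p))) (w.drop i)) ↔ i = w.length := by
    intro i hi
    have hil := (mem_activeGaps.1 hi).1
    have hx : ∀ z ∈ w.drop i, m < z := fun z hz => hw z (List.mem_of_mem_drop hz)
    have key : BlockedBy [false, false] [true] m
        (m :: (w.take p ++ m :: (w.drop p).take (i - p))) (w.drop i) ↔ w.drop i ≠ [] := by
      rw [← exists_singleton_sublist_iff hx]
      simp [BlockedBy, spell]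
    rw [key, not_not, List.drop_eq_nil_iff]
    lia
  rw [card_activeGaps_insertEdge (by simp) hw hpl, Finset.filter_congr (q := (· ≤ p)),
    singleton_filter_card (length_mem_activeGaps (by simp) w) hone]
  · lia
  · intro i _
    have h1 : m ∉ w.take i := fun h => lt_irrefl _ (hw _ (List.mem_of_mem_take h))
    simp [BlockedBy, spell, h1]

/-- The pattern 12321. An edge that ends in gap `0` blocks nothing; any other edge blocks all gaps
behind it. -/
theorem ternaryRule_12321 : TernaryRule [false, true, false] [] := by
  classical
  intro m w hw f
  set G := activeGaps [false, true, false] [] w with hG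
  have h0 : 0 ∈ G := zero_mem_activeGaps (by simp) w
  have hin (p i : ℕ) : ¬ BlockedBy [false, true, false] [] m (m :: w.take i)
      ((w.take p).drop i ++ m :: w.drop p) := by
    have h1 : m ∉ w.take i := fun h => lt_irrefl _ (hw _ (List.mem_of_mem_take h))
    have h2 (c : ℤ) : ¬ List.Sublist [c, m] (w.take i) := fun h => h1 (h.subset (by simp))
    simp [BlockedBy, spell, h2]
  have hout (p i : ℕ) : BlockedBy [false, true, false] [] m
      (m :: (w.take p ++ m :: (w.drop p).take (i - p))) (w.drop i) ↔ w.take p ≠ [] := by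
    have hx : ∀ z ∈ w.take p, m < z := fun z hz => hw z (List.mem_of_mem_take hz)
    have hy : ∀ z ∈ (w.drop p).take (i - p), m < z :=
      fun z hz => hw z (List.mem_of_mem_drop (List.mem_of_mem_take hz))
    rw [← exists_singleton_sublist_iff hx]
    refine exists_congr fun c => and_congr_right fun hc => ?_
    have := append_cons_sublist_iff (l := [c]) (r := []) (fun h => lt_irrefl _ (hx _ h))
      (fun h => lt_irrefl _ (hy _ h)) (by simpa using hc.ne)
    simpa [spell] using this
  have hcard : G.card = (G.erase 0).card + 1 := (Finset.card_erase_add_one h0).symm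
  rw [← Finset.add_sum_erase G _ h0, hcard, Finset.sum_range_succ, add_comm,
    ← Finset.sum_card_filter_le _ fun k => f (k + 2)]
  congr 1
  · refine Finset.sum_congr rfl fun p hp => ?_
    obtain ⟨hp0, hpG⟩ := Finset.mem_erase.1 hp
    have hpl := (mem_activeGaps.1 hpG).1
    have hne : w.take p ≠ [] := by
      rw [Ne, List.take_eq_nil_iff]
      rintro (h | rfl)
      · exact hp0 h
      · exact hp0 (by simpa using hpl)
    rw [card_activeGaps_insertEdge (by simp) hw hpl]
    simp only [hin, hout, hne, not_false_eq_true, and_true, ne_eq, not_true_eq_false, and_false,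
      Finset.filter_false, Finset.card_empty, add_zero]
    rw [← hG, ← Finset.insert_erase h0, Finset.filter_insert, if_pos (Nat.zero_le p),
      Finset.card_insert_of_notMem (by simp), Finset.erase_insert (by simp)]
    congr 1
    lia
  · rw [card_activeGaps_insertEdge (by simp) hw (Nat.zero_le _)]
    simp only [hin, hout, not_false_eq_true, and_true]
    simp only [List.take_zero, ne_eq, not_true_eq_false, not_false_eq_true, zero_le, and_true,
      Finset.filter_true]
    rw [singleton_filter_card h0 (by simp), ← hG, hcard]
    congr 1
    lia

/-- The pattern 12123. An edge that ends in the last gap blocks nothing; any other edge blocks all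
gaps between its ends. -/
theorem ternaryRule_12123 : TernaryRule [false] [false, true] := by
  classical
  intro m w hw f
  set G := activeGaps [false] [false, true] w with hG
  have hL : w.length ∈ G := length_mem_activeGaps (by simp) w
  have hin (p i : ℕ) : BlockedBy [false] [false, true] m (m :: w.take i)
      ((w.take p).drop i ++ m :: w.drop p) ↔ w.drop p ≠ [] := by
    have hy : ∀ z ∈ w.drop p, m < z := fun z hz => hw z (List.mem_of_mem_drop hz)
    have hx : ∀ z ∈ (w.take p).drop i, m < z :=
      fun z hz => hw z (List.mem_of_mem_take (List.mem_of_mem_drop hz))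
    rw [← exists_singleton_sublist_iff hy]
    refine exists_congr fun c => and_congr_right fun hc => ?_
    have := append_cons_sublist_iff (l := []) (r := [c]) (fun h => lt_irrefl _ (hx _ h))
      (fun h => lt_irrefl _ (hy _ h)) (by simp)
    simpa [spell] using this
  have hout (p i : ℕ) : ¬ BlockedBy [false] [false, true] m
      (m :: (w.take p ++ m :: (w.drop p).take (i - p))) (w.drop i) := by
    have h1 : m ∉ w.drop i := fun h => lt_irrefl _ (hw _ (List.mem_of_mem_drop h))
    have h2 (c : ℤ) : ¬ List.Sublist [m, c] (w.drop i) := fun h => h1 (h.subset (by simp))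
    simp [BlockedBy, spell, h2]
  have hcard : G.card = (G.erase w.length).card + 1 := (Finset.card_erase_add_one hL).symm
  rw [← Finset.add_sum_erase G _ hL, hcard, Finset.sum_range_succ, add_comm,
    ← Finset.sum_card_filter_ge _ fun k => f (k + 2)]
  congr 1
  · refine Finset.sum_congr rfl fun p hp => ?_
    obtain ⟨hp0, hpG⟩ := Finset.mem_erase.1 hp
    have hpl := (mem_activeGaps.1 hpG).1
    have hne : w.drop p ≠ [] := by
      rw [Ne, List.drop_eq_nil_iff]
      lia
    rw [card_activeGaps_insertEdge (by simp) hw hpl]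
    simp only [hin, hout, hne, not_false_eq_true, and_true, ne_eq, not_true_eq_false, and_false,
      Finset.filter_false, Finset.card_empty, add_zero]
    rw [← hG, ← Finset.insert_erase hL, Finset.filter_insert, if_pos hpl,
      Finset.card_insert_of_notMem (by simp), Finset.erase_insert (by simp)]
    congr 1
    lia
  · rw [card_activeGaps_insertEdge (by simp) hw le_rfl]
    simp only [hin, hout, not_false_eq_true, and_true]
    simp only [List.drop_length, ne_eq, not_true_eq_false, not_false_eq_true, and_true]
    rw [singleton_filter_card (P := fun i => w.length ≤ i) hL, Finset.filter_true_of_mem,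
      ← hG, hcard]
    · congr 1
      lia
    · exact fun i hi => (mem_activeGaps.1 hi).1
    · intro i hi
      have := (mem_activeGaps.1 hi).1
      lia

/-! ### Canonical words -/

/-- The words that arise from canonical sequential forms with `n` edges by subtracting `n` from
all labels: each of the letters `-n + 1, …, 0` occurs twice, and smaller letters occur first (for
letters occurring twice, `j` first occurs before `k` unless `k j j` is a subsequence). With these
labels the insertion of a new first edge does not change the labels of the other edges. -/
def IsCanonicalWord (n : ℕ) (w : List ℤ) : Prop :=
  (∀ k : ℤ, w.count k = if -(n : ℤ) < k ∧ k ≤ 0 then 2 else 0) ∧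
    ∀ j k : ℤ, j < k → ¬ List.Sublist [k, j, j] w

theorem IsCanonicalWord.mem_iff {n : ℕ} {w : List ℤ} (h : IsCanonicalWord n w) {x : ℤ} :
    x ∈ w ↔ -(n : ℤ) < x ∧ x ≤ 0 := by
  rw [← List.count_pos_iff, h.1 x]
  split_ifs with hx <;> simp [hx]

theorem isCanonicalWord_zero {w : List ℤ} : IsCanonicalWord 0 w ↔ w = [] := by
  constructor
  · intro h
    rw [List.eq_nil_iff_forall_not_mem]
    intro x hx
    have := h.mem_iff.1 hx
    push_cast at this
    lia
  · rintro rfl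
    refine ⟨fun k => ?_, by simp⟩
    rw [if_neg (by push_cast; lia)]
    simp

theorem IsCanonicalWord.insertEdge {n : ℕ} {w : List ℤ} (h : IsCanonicalWord n w) (p : ℕ) :
    IsCanonicalWord (n + 1) (insertEdge (-n) w p) := by
  have hw : ∀ x ∈ w, -(n : ℤ) < x := fun x hx => (h.mem_iff.1 hx).1
  have hx : ∀ z ∈ w.take p, -(n : ℤ) < z := fun z hz => hw z (List.mem_of_mem_take hz)
  have hy : ∀ z ∈ w.drop p, -(n : ℤ) < z := fun z hz => hw z (List.mem_of_mem_drop hz)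
  have hcount (k : ℤ) : (_root_.insertEdge (-n) w p).count k =
      w.count k + if k = -(n : ℤ) then 2 else 0 := by
    conv_rhs => rw [← List.take_append_drop p w, List.count_append]
    simp only [_root_.insertEdge, List.count_cons, List.count_append]
    rcases eq_or_ne k (-(n : ℤ)) with rfl | hk
    · simp; lia
    · simp [hk, hk.symm]
  refine ⟨fun k => ?_, fun j k hjk hs => ?_⟩
  · rw [hcount, h.1 k]
    push_cast
    split_ifs <;> lia
  · have hj : j ∈ _root_.insertEdge (-n) w p := hs.subset (by simp)
    have hmk : -(n : ℤ) < k := by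
      rcases mem_insertEdge.1 hj with rfl | hj
      · exact hjk
      · exact (hw j hj).trans hjk
    rcases mem_insertEdge.1 hj with rfl | hj
    · -- the first letter is `-n`, so only one `-n` is left behind an occurrence of `k`
      rw [_root_.insertEdge] at hs
      have h1 := (List.sublist_cons_iff.1 hs).resolve_right (by simp [hmk.ne'])
      have h2 := h1.count_le (-(n : ℤ))
      have hxn : -(n : ℤ) ∉ w.take p := fun h => lt_irrefl _ (hx _ h)
      have hyn : -(n : ℤ) ∉ w.drop p := fun h => lt_irrefl _ (hy _ h)
      simp [List.count_append, List.count_eq_zero_of_not_mem hxn,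
        List.count_eq_zero_of_not_mem hyn, hmk.ne'] at h2
    · have hf : (_root_.insertEdge (-n) w p).filter (· ≠ -(n : ℤ)) = w := by
        rw [_root_.insertEdge, filter_ne_cons_append_cons hx hy, List.take_append_drop]
      refine h.2 j k hjk ?_
      rwa [← hf, sublist_filter_ne_iff]
      simp [hmk.ne, (hw j hj).ne]

/-- Every canonical word with at least one edge arises by adding a first edge. -/
theorem IsCanonicalWord.exists_insertEdge {n : ℕ} {z : List ℤ} (h : IsCanonicalWord (n + 1) z) :
    ∃ w p, IsCanonicalWord n w ∧ p ≤ w.length ∧ z = _root_.insertEdge (-n) w p := by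
  have hc : z.count (-(n : ℤ)) = 2 := by
    rw [h.1, if_pos]
    push_cast
    lia
  cases z with
  | nil => simp at hc
  | cons a r =>
    have ha : a = -(n : ℤ) := by
      by_contra hne
      have h1 := h.mem_iff.1 (List.mem_cons_self (a := a) (l := r))
      push_cast at h1
      rw [List.count_cons_of_ne hne] at hc
      refine h.2 (-n) a (by lia) ?_
      have := List.replicate_sublist_iff.2 hc.ge
      exact this.cons_cons a
    subst ha
    rw [List.count_cons_self] at hc
    have hmem : -(n : ℤ) ∈ r := List.count_pos_iff.1 (by lia)
    obtain ⟨x, y, rfl⟩ := List.append_of_mem hmem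
    refine ⟨x ++ y, x.length, ⟨fun k => ?_, fun j k hjk hs => h.2 j k hjk ?_⟩, by simp, ?_⟩
    · have h1 := h.1 k
      have h2 : (-(n : ℤ) :: (x ++ -(n : ℤ) :: y)).count k =
          (x ++ y).count k + if k = -(n : ℤ) then 2 else 0 := by
        simp only [List.count_cons, List.count_append]
        rcases eq_or_ne k (-(n : ℤ)) with rfl | hk
        · simp; lia
        · simp [hk, hk.symm]
      rw [h2] at h1
      push_cast at h1
      split_ifs at h1 ⊢ <;> lia
    · exact hs.trans ((List.sublist_cons_self _ _).append_left x |>.trans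
        (List.sublist_cons_self _ _))
    · simp [_root_.insertEdge]

theorem insertEdge_injective {m : ℤ} {w w' : List ℤ} {p p' : ℕ} (hw : m ∉ w) (hw' : m ∉ w')
    (hp : p ≤ w.length) (hp' : p' ≤ w'.length) (h : insertEdge m w p = insertEdge m w' p') :
    w = w' ∧ p = p' := by
  simp only [insertEdge, List.cons.injEq, true_and] at h
  have h1 : m ∉ w.take p := fun h => hw (List.mem_of_mem_take h)
  have h2 : m ∉ w'.take p' := fun h => hw' (List.mem_of_mem_take h)
  have h3 : m ∉ w.drop p := fun h => hw (List.mem_of_mem_drop h)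
  have h4 : m ∉ w'.drop p' := fun h => hw' (List.mem_of_mem_drop h)
  have h5 := (append_cons_sublist_iff h2 h4 h1).1 (by rw [h])
  have h6 := (append_cons_sublist_iff h1 h3 h2).1 (by rw [h])
  have h7 := h5.1.antisymm h6.1
  have h8 := h5.2.antisymm h6.2
  constructor
  · rw [← List.take_append_drop p w, h7, h8, List.take_append_drop]
  · have := congrArg List.length h7
    simpa [hp, hp'] using this

/-! ### Counting the avoiding words -/

/-- The canonical words with `n` edges that avoid the pattern `1 s 1 t`, generated by adding a new
first edge that ends in an active gap. -/
noncomputable def avoidingWords (s t : List Bool) : ℕ → Finset (List ℤ)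
  | 0 => {[]}
  | n + 1 => ((avoidingWords s t n).sigma fun w => activeGaps s t w).image
      fun q => insertEdge (-n) q.1 q.2

theorem mem_avoidingWords {s t : List Bool} (hs : false ∈ s) {n : ℕ} {w : List ℤ} :
    w ∈ avoidingWords s t n ↔ IsCanonicalWord n w ∧ ¬ HasPattern s t w := by
  induction n generalizing w with
  | zero =>
    rw [avoidingWords, Finset.mem_singleton, isCanonicalWord_zero, iff_self_and]
    rintro rfl
    simp [HasPattern]
  | succ n ih =>
    simp only [avoidingWords, Finset.mem_image, Finset.mem_sigma, Sigma.exists, ih,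
      mem_activeGaps]
    constructor
    · rintro ⟨w, p, ⟨⟨hw, h1⟩, hp, h2⟩, rfl⟩
      refine ⟨hw.insertEdge p, ?_⟩
      rw [hasPattern_insertEdge hs fun x hx => (hw.mem_iff.1 hx).1]
      tauto
    · rintro ⟨hw, h1⟩
      obtain ⟨w, p, hw', hp, rfl⟩ := hw.exists_insertEdge
      rw [hasPattern_insertEdge hs fun x hx => (hw'.mem_iff.1 hx).1] at h1
      exact ⟨w, p, ⟨⟨hw', by tauto⟩, hp, by tauto⟩, rfl⟩

/-- Both sides count the avoiding words with `n + k` edges: on the left, `k` further first edges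
are added to the avoiding words with `n` edges; on the right, `n + k` edges to the empty word. -/
theorem sum_avoidingWords {s t : List Bool} (hs : false ∈ s) (h : TernaryRule s t) (n k : ℕ) :
    ∑ w ∈ avoidingWords s t n, ternaryCount k (activeGaps s t w).card =
      ternaryCount (n + k) (activeGaps s t []).card := by
  induction n generalizing k with
  | zero => simp [avoidingWords]
  | succ n ih =>
    rw [avoidingWords, Finset.sum_image, Finset.sum_sigma, show n + 1 + k = n + (k + 1) by lia,
      ← ih]
    · refine Finset.sum_congr rfl fun w hw => ?_
      exact h (-n) w (fun x hx => (((mem_avoidingWords hs).1 hw).1.mem_iff.1 hx).1) _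
    · rintro ⟨w, p⟩ hq ⟨w', p'⟩ hq' he
      simp only [Finset.mem_coe, Finset.mem_sigma, mem_avoidingWords hs, mem_activeGaps] at hq hq'
      have hn {w : List ℤ} (hw : IsCanonicalWord n w) : -(n : ℤ) ∉ w :=
        fun h => lt_irrefl _ (hw.mem_iff.1 h).1
      obtain ⟨rfl, rfl⟩ := insertEdge_injective (hn hq.1.1) (hn hq'.1.1) hq.2.1 hq'.2.1 he
      rfl

theorem card_avoidingWords {s t : List Bool} (hs : false ∈ s) (h : TernaryRule s t) (n : ℕ) :
    (avoidingWords s t n).card = ternaryCount n 1 := by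
  have h1 : (activeGaps s t []).card = 1 := by
    have hz := zero_mem_activeGaps hs (t := t) []
    rw [Finset.card_eq_one]
    refine ⟨0, Finset.eq_singleton_iff_unique_mem.2 ⟨hz, fun x hx => ?_⟩⟩
    simpa using (mem_activeGaps.1 hx).1
  have h2 := sum_avoidingWords hs h n 0
  simpa [ternaryCount, h1] using h2

/-! ### Matchings and canonical words -/

theorem sublist_ofFn_iff {α : Type*} {N : ℕ} {l : List α} {g : Fin N → α} :
    List.Sublist l (List.ofFn g) ↔
      ∃ f : Fin l.length → Fin N, StrictMono f ∧ ∀ i, l.get i = g (f i) := by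
  rw [List.sublist_iff_exists_fin_orderEmbedding_get_eq]
  constructor
  · rintro ⟨f, hf⟩
    refine ⟨fun i => Fin.castOrderIso List.length_ofFn (f i), fun i j hij => ?_, fun i => ?_⟩
    · exact (Fin.castOrderIso _).strictMono (f.strictMono hij)
    · rw [hf i, List.get_ofFn]
      rfl
  · rintro ⟨f, hf, h⟩
    refine ⟨(OrderEmbedding.ofStrictMono f hf).trans
      (Fin.castOrderIso List.length_ofFn.symm).toOrderEmbedding, fun i => ?_⟩
    rw [h i, List.get_ofFn]
    rfl

theorem count_ofFn_eq_card {α : Type*} [DecidableEq α] {N : ℕ} (g : Fin N → α) (k : α) :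
    (List.ofFn g).count k = (Finset.univ.filter fun v => g v = k).card := by
  rw [Finset.card_filter]
  induction N with
  | zero => simp
  | succ N ih =>
    rw [List.ofFn_succ, List.count_cons, ih, Fin.sum_univ_succ, add_comm]
    simp

theorem IsCanonicalWord.length_eq {n : ℕ} {w : List ℤ} (h : IsCanonicalWord n w) :
    w.length = 2 * n := by
  induction n generalizing w with
  | zero => simp [isCanonicalWord_zero.1 h]
  | succ n ih =>
    obtain ⟨w, p, hw, hp, rfl⟩ := h.exists_insertEdge
    have := ih hw
    simp [_root_.insertEdge]
    lia

namespace Matching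

variable {n : ℕ} (M : Matching n)

theorem card_parts : M.1.parts.card = n := by
  have h := M.1.sum_card_parts
  rw [Finset.sum_congr rfl M.2] at h
  simp at h
  lia

theorem min_injOn {B C : Finset (Fin (2 * n))} (hB : B ∈ M.1.parts) (hC : C ∈ M.1.parts)
    (h : B.min = C.min) : B = C := by
  obtain ⟨a, ha⟩ := Finset.min_of_nonempty (M.1.nonempty_of_mem_parts hB)
  exact M.1.eq_of_mem_parts hB hC (Finset.mem_of_min ha) (Finset.mem_of_min (h ▸ ha))

theorem part_mem (v : Fin (2 * n)) : M.1.part v ∈ M.1.parts :=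
  M.1.part_mem.2 (Finset.mem_univ v)

theorem canonicalForm_lt_iff {u v : Fin (2 * n)} :
    M.canonicalForm u < M.canonicalForm v ↔ (M.1.part u).min < (M.1.part v).min := by
  have mono {u v : Fin (2 * n)} (h : (M.1.part u).min ≤ (M.1.part v).min) :
      M.canonicalForm u ≤ M.canonicalForm v :=
    Finset.card_le_card fun B hB => by
      rw [Finset.mem_filter] at hB ⊢
      exact ⟨hB.1, hB.2.trans h⟩
  constructor
  · intro h
    by_contra h'
    exact absurd (mono (not_lt.1 h')) (not_le.2 h)
  · intro h
    refine Finset.card_lt_card ⟨fun B hB => ?_, fun hsub => ?_⟩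
    · rw [Finset.mem_filter] at hB ⊢
      exact ⟨hB.1, hB.2.trans h.le⟩
    · have := hsub (Finset.mem_filter.2 ⟨M.part_mem v, le_rfl⟩)
      exact absurd (Finset.mem_filter.1 this).2 (not_le.2 h)

theorem canonicalForm_eq_iff {u v : Fin (2 * n)} :
    M.canonicalForm u = M.canonicalForm v ↔ M.1.part u = M.1.part v := by
  constructor
  · intro h
    refine M.min_injOn (M.part_mem u) (M.part_mem v) (le_antisymm ?_ ?_)
    · exact not_lt.1 fun h' => (M.canonicalForm_lt_iff.2 h').ne' h
    · exact not_lt.1 fun h' => (M.canonicalForm_lt_iff.2 h').ne h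
  · intro h
    rw [canonicalForm, canonicalForm, h]

theorem mem_part_iff {u v : Fin (2 * n)} : u ∈ M.1.part v ↔
    M.canonicalForm u = M.canonicalForm v := by
  rw [canonicalForm_eq_iff, M.1.part_eq_iff_mem (M.part_mem v)]

theorem canonicalForm_mem_Icc (v : Fin (2 * n)) : M.canonicalForm v ∈ Finset.Icc 1 n := by
  refine Finset.mem_Icc.2 ⟨Finset.card_pos.2 ⟨M.1.part v, ?_⟩, ?_⟩
  · exact Finset.mem_filter.2 ⟨M.part_mem v, le_rfl⟩
  · exact (Finset.card_filter_le _ _).trans M.card_parts.le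

theorem exists_canonicalForm_eq {k : ℕ} (hk : k ∈ Finset.Icc 1 n) :
    ∃ v, M.canonicalForm v = k := by
  have hex (B : M.1.parts) : ∃ v, M.1.part v = B := by
    obtain ⟨v, hv⟩ := M.1.nonempty_of_mem_parts B.2
    exact ⟨v, M.1.part_eq_of_mem B.2 hv⟩
  choose φ hφ using hex
  have hcard : ((Finset.univ.image fun B => M.canonicalForm (φ B))).card = n := by
    rw [Finset.card_image_of_injective]
    · simp [M.card_parts]
    · intro B C h
      have := M.canonicalForm_eq_iff.1 h
      rw [hφ, hφ] at this
      exact Subtype.ext this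
  have himage := Finset.eq_of_subset_of_card_le
    (s := Finset.univ.image fun B => M.canonicalForm (φ B)) (t := Finset.Icc 1 n)
    (fun x hx => by
      obtain ⟨B, -, rfl⟩ := Finset.mem_image.1 hx
      exact M.canonicalForm_mem_Icc _) (by rw [hcard]; simp)
  rw [← himage] at hk
  obtain ⟨B, -, rfl⟩ := Finset.mem_image.1 hk
  exact ⟨_, rfl⟩

/-- The canonical sequential form, shifted so that its labels are `-n + 1, …, 0`. -/
def word : List ℤ := List.ofFn fun v => (M.canonicalForm v : ℤ) - n

theorem isCanonicalWord_word : IsCanonicalWord n M.word := by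
  refine ⟨fun k => ?_, fun j k hjk hs => ?_⟩
  · rw [word, count_ofFn_eq_card]
    split_ifs with hk
    · obtain ⟨v, hv⟩ := M.exists_canonicalForm_eq (k := (k + n).toNat)
        (Finset.mem_Icc.2 (by lia))
      refine Eq.trans (congrArg Finset.card ?_) (M.2 _ (M.part_mem v))
      ext u
      rw [M.mem_part_iff, Finset.mem_filter_univ]
      lia
    · rw [Finset.card_eq_zero, Finset.filter_eq_empty_iff]
      intro v _ hv
      have := Finset.mem_Icc.1 (M.canonicalForm_mem_Icc v)
      lia
  · obtain ⟨f, hf, h⟩ := sublist_ofFn_iff.1 hs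
    have h0 : k = (M.canonicalForm (f 0) : ℤ) - n := h 0
    have h1 : j = (M.canonicalForm (f 1) : ℤ) - n := h 1
    have h2 : j = (M.canonicalForm (f 2) : ℤ) - n := h 2
    have h01 : f 0 < f 1 := hf (show (0 : Fin 3) < 1 by decide)
    have h12 : f 1 < f 2 := hf (show (1 : Fin 3) < 2 by decide)
    -- the edge through `f 1` and `f 2` would have a third node, its initial point
    obtain ⟨x, hx⟩ := Finset.min_of_nonempty (M.1.nonempty_of_mem_parts (M.part_mem (f 1)))
    have hlt : (M.1.part (f 1)).min < (M.1.part (f 0)).min := M.canonicalForm_lt_iff.1 (by lia)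
    have hle : (M.1.part (f 0)).min ≤ f 0 := Finset.min_le (M.mem_part_iff.2 rfl)
    have hx0 : x < f 0 := by
      rw [hx] at hlt
      exact WithTop.coe_lt_coe.1 (hlt.trans_le hle)
    have hsub : ({x, f 1, f 2} : Finset (Fin (2 * n))) ⊆ M.1.part (f 1) := by
      intro y hy
      simp only [Finset.mem_insert, Finset.mem_singleton] at hy
      rcases hy with rfl | rfl | rfl
      · exact Finset.mem_of_min hx
      · exact M.mem_part_iff.2 rfl
      · exact M.mem_part_iff.2 (by lia)
    have hcard := Finset.card_le_card hsub
    rw [M.2 _ (M.part_mem _), Finset.card_eq_three.2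
      ⟨x, f 1, f 2, (hx0.trans h01).ne, (hx0.trans (h01.trans h12)).ne, h12.ne, rfl⟩] at hcard
    lia

theorem word_injective : Function.Injective (word (n := n)) := by
  intro M M' h
  have hc (v : Fin (2 * n)) : M.canonicalForm v = M'.canonicalForm v := by
    have := congrFun (List.ofFn_injective h) v
    simpa using this
  have hpart (v : Fin (2 * n)) : M.1.part v = M'.1.part v := by
    ext u
    rw [M.mem_part_iff, M'.mem_part_iff, hc, hc]
  have hsub (M M' : Matching n) (h : ∀ v, M.1.part v = M'.1.part v) :
      M.1.parts ⊆ M'.1.parts := by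
    intro B hB
    obtain ⟨v, hv⟩ := M.1.nonempty_of_mem_parts hB
    rw [← M.1.part_eq_of_mem hB hv, h]
    exact M'.part_mem v
  exact Subtype.ext (Finpartition.ext
    ((hsub M M' hpart).antisymm (hsub M' M fun v => (hpart v).symm)))

end Matching

/-- Every canonical word comes from a matching, namely the partition of the positions according to
their letters. -/
theorem IsCanonicalWord.exists_matching {n : ℕ} {w : List ℤ} (h : IsCanonicalWord n w) :
    ∃ M : Matching n, M.word = w := by
  classical
  obtain ⟨g, rfl⟩ : ∃ g : Fin (2 * n) → ℤ, w = List.ofFn g :=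
    ⟨fun i => w.get (i.cast h.length_eq.symm), by
      refine List.ext_get (by simp [h.length_eq]) fun i h1 h2 => by simp⟩
  let fibre (k : ℤ) : Finset (Fin (2 * n)) := Finset.univ.filter fun v => g v = k
  have hfib (k : ℤ) : (fibre k).card = if -(n : ℤ) < k ∧ k ≤ 0 then 2 else 0 := by
    rw [← h.1 k, count_ofFn_eq_card]
  have hg (v : Fin (2 * n)) : -(n : ℤ) < g v ∧ g v ≤ 0 := h.mem_iff.1 (by simp)
  have hmin {k l : ℤ} (hk : -(n : ℤ) < k ∧ k ≤ 0) (hl : -(n : ℤ) < l ∧ l ≤ 0) (hkl : k < l) :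
      (fibre k).min < (fibre l).min := by
    obtain ⟨y, hy⟩ := Finset.min_of_nonempty
      (Finset.card_pos.1 (by rw [hfib, if_pos hl]; lia) : (fibre l).Nonempty)
    have hyl : g y = l := (Finset.mem_filter.1 (Finset.mem_of_min hy)).2
    have h1 : 1 < (fibre k).card := by rw [hfib, if_pos hk]; lia
    rw [hy]
    by_contra hle
    obtain ⟨a, ha, b, hb, hab⟩ : ∃ a ∈ fibre k, ∃ b ∈ fibre k, a < b := by
      obtain ⟨a, ha, b, hb, hab⟩ := Finset.one_lt_card.1 h1
      rcases hab.lt_or_gt with hab | hab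
      · exact ⟨a, ha, b, hb, hab⟩
      · exact ⟨b, hb, a, ha, hab⟩
    have hya : y ≤ a := WithTop.coe_le_coe.1 ((not_lt.1 hle).trans (Finset.min_le ha))
    have hak : g a = k := (Finset.mem_filter.1 ha).2
    have hbk : g b = k := (Finset.mem_filter.1 hb).2
    have hya : y < a := hya.lt_of_ne (by rintro rfl; lia)
    refine h.2 k l hkl (sublist_ofFn_iff.2 ⟨![y, a, b], ?_, ?_⟩)
    · refine Fin.strictMono_iff_lt_succ.2 fun i => ?_
      fin_cases i
      · exact hya
      · exact hab
    · intro i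
      fin_cases i
      · exact hyl.symm
      · exact hak.symm
      · exact hbk.symm
  have hle {k l : ℤ} (hk : -(n : ℤ) < k ∧ k ≤ 0) (hl : -(n : ℤ) < l ∧ l ≤ 0) :
      (fibre k).min ≤ (fibre l).min ↔ k ≤ l := by
    constructor
    · intro h'
      by_contra hkl
      exact absurd (hmin hl hk (not_le.1 hkl)) (not_lt.2 h')
    · intro hkl
      rcases hkl.eq_or_lt with rfl | hkl
      · exact le_rfl
      · exact (hmin hk hl hkl).le
  let P := Finpartition.ofSetoid (Setoid.ker g)
  have hpart (v : Fin (2 * n)) : P.part v = fibre (g v) := by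
    ext u
    rw [Finpartition.mem_part_ofSetoid_iff_rel, Finset.mem_filter_univ]
    exact eq_comm
  have hparts {B : Finset (Fin (2 * n))} (hB : B ∈ P.parts) : ∃ v, B = fibre (g v) := by
    obtain ⟨v, hv⟩ := P.nonempty_of_mem_parts hB
    exact ⟨v, by rw [← P.part_eq_of_mem hB hv, hpart]⟩
  let M : Matching n := ⟨P, fun B hB => by
    obtain ⟨v, rfl⟩ := hparts hB
    rw [hfib, if_pos (hg v)]⟩
  refine ⟨M, congrArg List.ofFn (funext fun v => ?_)⟩
  -- the edges that start not to the right of the edge at `v` are those with label at most `g v`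
  have hcount : M.canonicalForm v = ((Finset.Ioc (-(n : ℤ)) (g v)).image fibre).card := by
    rw [Matching.canonicalForm]
    congr 1
    ext B
    simp only [Finset.mem_filter, Finset.mem_image, Finset.mem_Ioc]
    constructor
    · rintro ⟨hB, hBv⟩
      obtain ⟨u, rfl⟩ := hparts hB
      change _ ≤ (P.part v).min at hBv
      rw [hpart, hle (hg u) (hg v)] at hBv
      exact ⟨g u, ⟨(hg u).1, hBv⟩, rfl⟩
    · rintro ⟨k, ⟨hk1, hk2⟩, rfl⟩
      have hk : -(n : ℤ) < k ∧ k ≤ 0 := ⟨hk1, hk2.trans (hg v).2⟩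
      obtain ⟨u, hu⟩ : (fibre k).Nonempty :=
        Finset.card_pos.1 (by rw [hfib, if_pos hk]; lia)
      have huk : g u = k := (Finset.mem_filter.1 hu).2
      constructor
      · rw [← huk, ← hpart]
        exact P.part_mem.2 (Finset.mem_univ u)
      · change _ ≤ (P.part v).min
        rwa [hpart, hle hk (hg v)]
  have hinj : Set.InjOn fibre (Finset.Ioc (-(n : ℤ)) (g v)) := by
    intro k hk l hl hkl
    rw [Finset.coe_Ioc, Set.mem_Ioc] at hk hl
    obtain ⟨u, hu⟩ : (fibre k).Nonempty :=
      Finset.card_pos.1 (by rw [hfib, if_pos ⟨hk.1, hk.2.trans (hg v).2⟩]; lia)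
    have hu' : u ∈ fibre l := hkl ▸ hu
    exact (Finset.mem_filter.1 hu).2.symm.trans (Finset.mem_filter.1 hu').2
  rw [hcount, Finset.card_image_of_injOn hinj, Int.card_Ioc]
  have := (hg v).1
  lia

/-! ### Pattern containment -/

/-- A pattern with the letters `1, 2, 3` whose spelling is `1 s 1 t` is contained in a matching
exactly if `1 s 1 t` occurs in its word. -/
theorem Matching.contains_iff_hasPattern {n k : ℕ} (M : Matching n) {s t : List Bool}
    {τ : Fin k → ℕ} (hτ : ∀ i, τ i = 1 ∨ τ i = 2 ∨ τ i = 3) (h1 : ∃ i, τ i = 1)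
    (h2 : ∃ i, τ i = 2) (h3 : ∃ i, τ i = 3)
    (hspell : ∀ a b c : ℤ, a :: (spell b c s ++ a :: spell b c t) =
      List.ofFn fun i => if τ i = 1 then a else if τ i = 2 then b else c) :
    M.Contains τ ↔ HasPattern s t M.word := by
  have hsub (a b c : ℤ) : List.Sublist (a :: (spell b c s ++ a :: spell b c t)) M.word ↔
      ∃ f : Fin k → Fin (2 * n), StrictMono f ∧ ∀ i,
        (if τ i = 1 then a else if τ i = 2 then b else c) = (M.canonicalForm (f i) : ℤ) - n := by
    rw [hspell, Matching.word, sublist_ofFn_iff]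
    constructor
    · rintro ⟨f, hf, h⟩
      refine ⟨fun i => f (Fin.cast (by simp) i), fun i j hij => hf hij, fun i => ?_⟩
      rw [← h, List.get_ofFn]
      rfl
    · rintro ⟨f, hf, h⟩
      refine ⟨fun i => f (Fin.cast (by simp) i), fun i j hij => hf hij, fun i => ?_⟩
      rw [← h, List.get_ofFn]
  constructor
  · rintro ⟨f, hf, ho⟩
    obtain ⟨i, hi⟩ := h1
    obtain ⟨j, hj⟩ := h2
    obtain ⟨l, hl⟩ := h3
    have hij := (ho i j).2 (by lia)
    have hjl := (ho j l).2 (by lia)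
    refine ⟨(M.canonicalForm (f i) : ℤ) - n, (M.canonicalForm (f j) : ℤ) - n,
      (M.canonicalForm (f l) : ℤ) - n, by lia, by lia, (hsub _ _ _).2 ⟨f, hf, fun x => ?_⟩⟩
    have heq (y : Fin k) (hy : τ x = τ y) : M.canonicalForm (f x) = M.canonicalForm (f y) := by
      have h1 := ho x y
      have h2 := ho y x
      simp only at h1 h2
      lia
    rcases hτ x with hx | hx | hx
    · rw [if_pos hx, heq i (hx.trans hi.symm)]
    · rw [if_neg (by lia), if_pos hx, heq j (hx.trans hj.symm)]
    · rw [if_neg (by lia), if_neg (by lia), heq l (hx.trans hl.symm)]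
  · rintro ⟨a, b, c, hab, hbc, h⟩
    obtain ⟨f, hf, h⟩ := (hsub a b c).1 h
    refine ⟨f, hf, fun i j => ?_⟩
    have hi := h i
    have hj := h j
    simp only
    rcases hτ i with h1 | h1 | h1 <;> rcases hτ j with h2 | h2 | h2 <;>
      simp only [h1, h2] at hi hj ⊢ <;> norm_num at hi hj ⊢ <;> lia

theorem ncard_avoidingMatchings {s t : List Bool} (hs : false ∈ s) (hrule : TernaryRule s t)
    {k : ℕ} {τ : Fin k → ℕ} (hτ : ∀ i, τ i = 1 ∨ τ i = 2 ∨ τ i = 3) (h1 : ∃ i, τ i = 1)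
    (h2 : ∃ i, τ i = 2) (h3 : ∃ i, τ i = 3)
    (hspell : ∀ a b c : ℤ, a :: (spell b c s ++ a :: spell b c t) =
      List.ofFn fun i => if τ i = 1 then a else if τ i = 2 then b else c) (n : ℕ) :
    ((avoidingMatchings n τ).ncard : ℚ) = kCatalan n 3 := by
  have himage : Matching.word '' avoidingMatchings n τ = avoidingWords s t n := by
    ext w
    rw [Finset.mem_coe, mem_avoidingWords hs]
    constructor
    · rintro ⟨M, hM, rfl⟩
      exact ⟨M.isCanonicalWord_word,
        fun h => hM ((M.contains_iff_hasPattern hτ h1 h2 h3 hspell).2 h)⟩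
    · rintro ⟨hw, h⟩
      obtain ⟨M, rfl⟩ := hw.exists_matching
      exact ⟨M, fun hM => h ((M.contains_iff_hasPattern hτ h1 h2 h3 hspell).1 hM), rfl⟩
  rw [← Set.ncard_image_of_injective _ Matching.word_injective, himage, Set.ncard_coe_finset,
    card_avoidingWords hs hrule, ternaryCount_one]

theorem mainTheorem2 :
    (∀ τ ∈ sixPatterns, ∀ n : ℕ, ((avoidingMatchings n τ).ncard : ℚ) = kCatalan n 3) ∧
      ∀ σ ∈ sixPatterns, ∀ τ ∈ sixPatterns, WilfEquivalent σ τ := by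
  have key : ∀ τ ∈ sixPatterns, ∀ n : ℕ,
      ((avoidingMatchings n τ).ncard : ℚ) = kCatalan n 3 := by
    intro τ hτ n
    simp only [sixPatterns, Set.mem_insert_iff, Set.mem_singleton_iff] at hτ
    rcases hτ with rfl | rfl | rfl | rfl | rfl | rfl
    · exact ncard_avoidingMatchings (by decide) ternaryRule_12312 (by decide) (by decide)
        (by decide) (by decide) (fun _ _ _ => rfl) n
    · exact ncard_avoidingMatchings (by decide) ternaryRule_12132 (by decide) (by decide)
        (by decide) (by decide) (fun _ _ _ => rfl) n
    · exact ncard_avoidingMatchings (by decide) ternaryRule_12123 (by decide) (by decide)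
        (by decide) (by decide) (fun _ _ _ => rfl) n
    · exact ncard_avoidingMatchings (by decide) ternaryRule_12321 (by decide) (by decide)
        (by decide) (by decide) (fun _ _ _ => rfl) n
    · exact ncard_avoidingMatchings (by decide) ternaryRule_12231 (by decide) (by decide)
        (by decide) (by decide) (fun _ _ _ => rfl) n
    · exact ncard_avoidingMatchings (by decide) ternaryRule_12213 (by decide) (by decide)
        (by decide) (by decide) (fun _ _ _ => rfl) n
  refine ⟨key, fun σ hσ τ hτ n => ?_⟩
  exact_mod_cast (key σ hσ n).trans (key τ hτ n).symm
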